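/- Let $l$ be a measurable path-loss function with $l\ge 0$, $0<\int_0^\infty r\,l(r)\,dr<\infty$ and $\int_0^\infty r\,l(r)^2\,dr<\infty$. At time $0$ interferers are placed in $\mathbb{R}^2$ as a homogeneous Poisson point process of intensity $\Lambda\in(0,\infty)$, with points $X_0(0),X_1(0),\dots$. Given the initial positions, the interferers move independently of each other: the trajectory $(X_j(s))_{s\ge 0}$ has law $K(X_j(0),\cdot)$ for a probability kernel $K$ from $\mathbb{R}^2$ to paths, and the motion preserves homogeneity, i.e. $\int_{\mathbb{R}^2}K(x,\{w: w(s)\in B\})\,dx=|B|$ for all Borel $B$ and all $s\ge 0$. (This holds for instance if displacements are i.i.d. across interferers and independent of the positions.) Fix a time $t\ge 0$ and suppose that the motion from time $t$ to time $t+1$ is described by a probability kernel $p$ on $\mathbb{R}^2$, $p(x,B)$ being the probability that a point at $x$ at time $t$ is in $B$ at time $t+1$; that is, $\int_{\mathbb{R}^2} K(x,\{w: w(t)\in A,\ w(t+1)\in B\})\,dx=\int_A p(x,B)\,dx$ for all Borel $A,B$. Let the fading processes $(F_j(s))_{s\ge 0}$ be nonnegative, independent across $j$, independent of the motion, with $F_j(s)$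 distributed as a random variable $h$ with $\mathbb{E}[h]=1$ and $\mathbb{E}[h^2]<\infty$, and such that $F_j(t)$ and $F_j(t+1)$ are independent for every $j$. Let $I_0(s)=\sum_j l(|X_j(s)|)F_j(s)$ be the interference at the origin, and $$\gamma(t,t+1)=\frac{\mathbb{E}[I_0(t)I_0(t+1)]-\mathbb{E}[I_0(t)]^2}{\mathbb{E}[I_0(t)^2]-\mathbb{E}[I_0(t)]^2}.$$ Then $I_0(t)$ and $I_0(t+1)$ are almost surely convergent and square integrable, $I_0(t)$ has positive variance, the integrals below converge, and $$\gamma(t,t+1)=\frac{\int_{\mathbb{R}^2} l(|x|)\int_{\mathbb{R}^2} l(|y|)\,p(x,dy)\,dx}{\mathbb{E}[h^2]\int_{\mathbb{R}^2} l(|x|)^2\,dx}.$$ -/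

import Mathlib

open MeasureTheory ProbabilityTheory
open scoped NNReal ENNReal

/-- The plane in which the interferers live. -/
abbrev Plane : Type := EuclideanSpace ℝ (Fin 2)

/-- The (random) counting measure `∑ⱼ δ_{x j}` of a sequence of points of the plane. -/
noncomputable def countingMeasure (x : ℕ → Plane) : Measure Plane :=
  Measure.sum fun j => Measure.dirac (x j)

/-- The random points `x 0, x 1, …` form a homogeneous Poisson point process of intensity `Λ`:
the number of points in a region `B` of finite area is Poisson with mean `Λ * area B`,
and the numbers of points in disjoint regions are independent. -/
structure IsPoissonProcess {Ω : Type*} [MeasurableSpace Ω] (μ : Measure Ω) (Λ : ℝ≥0)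
    (x : ℕ → Ω → Plane) : Prop where
  measurable : ∀ j, Measurable (x j)
  law_count : ∀ B : Set Plane, MeasurableSet B → volume B ≠ ∞ →
    μ.map (fun ω => countingMeasure (fun j => x j ω) B) =
      (poissonMeasure (Λ * (volume B).toNNReal)).map (fun n : ℕ => (n : ℝ≥0∞))
  indep_count : ∀ (n : ℕ) (B : Fin n → Set Plane), (∀ i, MeasurableSet (B i)) →
    (∀ i, volume (B i) ≠ ∞) → Pairwise (fun i j => Disjoint (B i) (B j)) →
    iIndepFun (fun i ω => countingMeasure (fun j => x j ω) (B i)) μ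

/-- The interferers with trajectories `X j : Ω → (time → Plane)` move independently of each other
according to the mobility kernel `K`: given all the initial positions, the trajectories are
independent, and the `j`-th one has law `K (X j 0)`. A mobility in which the displacements are
i.i.d. and independent of the positions is the case where `K x` is the law of `x + D` for a random
displacement path `D`. -/
structure MovesBy {Ω : Type*} [MeasurableSpace Ω] (μ : Measure Ω)
    (K : Kernel Plane (ℝ≥0 → Plane)) (X : ℕ → Ω → ℝ≥0 → Plane) : Prop where
  measurable : ∀ j, Measurable (X j)
  law_given_start : ∀ (A : Set (ℕ → Plane)), MeasurableSet A →
    ∀ (s : Finset ℕ) (B : ℕ → Set (ℝ≥0 → Plane)), (∀ j, MeasurableSet (B j)) →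
    μ ({ω | (fun j => X j ω 0) ∈ A} ∩ {ω | ∀ j ∈ s, X j ω ∈ B j}) =
      ∫⁻ ω in {ω | (fun j => X j ω 0) ∈ A}, ∏ j ∈ s, K (X j ω 0) (B j) ∂μ

/-- The mobility preserves homogeneity: if the starting points are spread over the plane with
constant intensity, then so are the positions at every later time. -/
def PreservesHomogeneity (K : Kernel Plane (ℝ≥0 → Plane)) : Prop :=
  ∀ t : ℝ≥0, ((volume : Measure Plane).bind K).map (fun w => w t) = volume

/-- `p x B` is the probability that an interferer which is at `x` at time `s` is in `B` at time
`t`: when the starting points are spread with unit intensity, the intensity of interferers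
that are in `A` at time `s` and in `B` at time `t` is `∫ x in A, p x B`. -/
def IsTransition (K : Kernel Plane (ℝ≥0 → Plane)) (s t : ℝ≥0) (p : Kernel Plane Plane) : Prop :=
  ∀ A B : Set Plane, MeasurableSet A → MeasurableSet B →
    ((volume : Measure Plane).bind K) {w | w s ∈ A ∧ w t ∈ B} = ∫⁻ x in A, p x B

/-- The fading processes `F j : Ω → (time → ℝ)` of the interferers: nonnegative, independent across
interferers, at all times distributed as the generic fading variable `h`. -/
structure IsFading {Ω : Type*} [MeasurableSpace Ω] (μ : Measure Ω)
    (F : ℕ → Ω → ℝ≥0 → ℝ) (h : Ω → ℝ) : Prop where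
  measurable : ∀ j, Measurable (F j)
  nonneg : 0 ≤ᵐ[μ] h
  identDistrib : ∀ j t, IdentDistrib (fun ω => F j ω t) h μ μ
  indep : iIndepFun F μ

/-- The interference at the origin at time `t`. -/
noncomputable def interference {Ω : Type*} (l : ℝ → ℝ) (X : ℕ → Ω → ℝ≥0 → Plane)
    (F : ℕ → Ω → ℝ≥0 → ℝ) (t : ℝ≥0) (ω : Ω) : ℝ :=
  ∑' j, l ‖X j ω t‖ * F j ω t

/-- The correlation coefficient `γ(s, t)` of a process `I` with constant mean and variance. -/
noncomputable def corrCoeff {Ω : Type*} [MeasurableSpace Ω] (μ : Measure Ω)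
    (I : ℝ≥0 → Ω → ℝ) (s t : ℝ≥0) : ℝ :=
  ((∫ ω, I s ω * I t ω ∂μ) - (∫ ω, I s ω ∂μ) ^ 2) /
    ((∫ ω, I s ω ^ 2 ∂μ) - (∫ ω, I s ω ∂μ) ^ 2)

/-! The product of two shot noises is a double sum over interferers. For a Poisson process, distinct
pairs of points have intensity Λ² dx dy (`IsPoissonProcess.sum_map_pair_eq`), and given the starting
points distinct interferers move independently, with independent fading. The off-diagonal terms
therefore sum to the product of the two means, which is exactly what the covariance and the variance
subtract.

Only the diagonal survives: Λ times the integral of the product of path losses along one trajectory,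
against the trajectory intensity `volume.bind K`, times a fading moment
(`lintegral_tsum_mark_mul_tsum_mark`). For the covariance, `IsTransition.lintegral_mul` turns the
integral into one against `p`, and the fading moment is 1 by decorrelation. For the variance,
homogeneity gives ∫ l², and the moment is E[h²]. The factor Λ cancels in the quotient.

All moments are computed in `ℝ≥0∞`, where sums and integrals commute freely; finiteness then
transfers them to the real-valued interference. -/

/-! ### Moments of the Poisson distribution. -/

/-- Since (n+1) · r^(n+1)/(n+1)! = r · r^n/n!, weighting by n shifts the index by one. The cases g =
1 and g = id give the first two moments. -/
theorem lintegral_natCast_mul_poissonMeasure (r : ℝ≥0) (g : ℕ → ℝ≥0∞) :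
    ∫⁻ n, (n : ℝ≥0∞) * g n ∂(poissonMeasure r) = r * ∫⁻ n, g (n + 1) ∂(poissonMeasure r) := by
  have h (f : ℕ → ℝ≥0∞) : ∫⁻ n, f n ∂(poissonMeasure r) =
      ∑' n : ℕ, f n * ENNReal.ofReal (Real.exp (-r) * r ^ n / n.factorial) := by
    rw [lintegral_countable']
    simp_rw [poissonMeasure_singleton]
  rw [h, h, tsum_eq_zero_add' ENNReal.summable, ← ENNReal.tsum_mul_left]
  simp only [CharP.cast_eq_zero, zero_mul, zero_add]
  refine tsum_congr fun n => ?_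
  have key : ((n + 1 : ℕ) : ℝ≥0∞) *
      ENNReal.ofReal (Real.exp (-r) * r ^ (n + 1) / (n + 1).factorial) =
      r * ENNReal.ofReal (Real.exp (-r) * r ^ n / n.factorial) := by
    rw [← ENNReal.ofReal_natCast, ← ENNReal.ofReal_coe_nnreal, ← ENNReal.ofReal_mul (by positivity),
      ← ENNReal.ofReal_mul (by positivity)]
    congr 1
    rw [Nat.factorial_succ]
    push_cast
    field_simp
    ring
  rw [mul_right_comm, key]
  ring

theorem lintegral_natCast_poissonMeasure (r : ℝ≥0) :
    ∫⁻ n, (n : ℝ≥0∞) ∂(poissonMeasure r) = r := by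
  simpa using lintegral_natCast_mul_poissonMeasure r (fun _ => 1)

theorem lintegral_natCast_mul_self_poissonMeasure (r : ℝ≥0) :
    ∫⁻ n, (n : ℝ≥0∞) * n ∂(poissonMeasure r) = r * r + r := by
  rw [lintegral_natCast_mul_poissonMeasure]
  push_cast
  rw [lintegral_add_right _ measurable_const, lintegral_natCast_poissonMeasure]
  simp [mul_add]

/-! ### Measures determined by sets of finite measure; diagonal splitting. -/

theorem MeasureTheory.Measure.ext_of_forall_measure_lt_top {α : Type*} [MeasurableSpace α]
    {μ ν : Measure α} (ρ : Measure α) [SigmaFinite ρ]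
    (h : ∀ s, MeasurableSet s → ρ s < ∞ → μ s = ν s) : μ = ν := by
  ext s hs
  have hU : s = ⋃ n, s ∩ spanningSets ρ n := by
    rw [← Set.inter_iUnion, iUnion_spanningSets, Set.inter_univ]
  have hm : Monotone fun n => s ∩ spanningSets ρ n :=
    fun m n hmn => Set.inter_subset_inter_right s (monotone_spanningSets ρ hmn)
  rw [hU, hm.measure_iUnion, hm.measure_iUnion]
  exact iSup_congr fun n => h _ (hs.inter (measurableSet_spanningSets ρ n))
    ((measure_mono Set.inter_subset_right).trans_lt (measure_spanningSets_lt_top ρ n))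

theorem MeasureTheory.generateFrom_measurableSet_measure_lt_top {α : Type*}
    [m : MeasurableSpace α] (μ : Measure α) [SigmaFinite μ] :
    MeasurableSpace.generateFrom {s | MeasurableSet s ∧ μ s < ∞} = m := by
  refine le_antisymm (MeasurableSpace.generateFrom_le fun s hs => hs.1) fun s hs => ?_
  have hU : s = ⋃ n, s ∩ spanningSets μ n := by
    rw [← Set.inter_iUnion, iUnion_spanningSets, Set.inter_univ]
  rw [hU]
  exact MeasurableSet.iUnion fun n => MeasurableSpace.measurableSet_generateFrom
    ⟨hs.inter (measurableSet_spanningSets μ n),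
      (measure_mono Set.inter_subset_right).trans_lt (measure_spanningSets_lt_top μ n)⟩

theorem MeasureTheory.isPiSystem_measure_lt_top {α : Type*} [MeasurableSpace α]
    (μ : Measure α) : IsPiSystem {s | MeasurableSet s ∧ μ s < ∞} := fun _ hs _ ht _ =>
  ⟨hs.1.inter ht.1, (measure_mono Set.inter_subset_left).trans_lt hs.2⟩

/-- A σ-finite measure is spanned by measurable sets of finite measure. -/
def MeasureTheory.Measure.finiteSpanningSetsIn_measure_lt_top {α : Type*} [MeasurableSpace α]
    (μ : Measure α) [SigmaFinite μ] :
    μ.FiniteSpanningSetsIn {s | MeasurableSet s ∧ μ s < ∞} :=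
  ⟨spanningSets μ, fun n => ⟨measurableSet_spanningSets μ n, measure_spanningSets_lt_top μ n⟩,
    measure_spanningSets_lt_top μ, iUnion_spanningSets μ⟩

/-- Needed because the Poisson counts are prescribed only on regions of finite area. -/
theorem MeasureTheory.Measure.prod_eq_of_forall_measure_lt_top {α β : Type*} [MeasurableSpace α]
    [MeasurableSpace β] {μ : Measure α} {ν : Measure β} [SigmaFinite μ] [SigmaFinite ν]
    {ρ : Measure (α × β)}
    (h : ∀ s t, MeasurableSet s → MeasurableSet t → μ s < ∞ → ν t < ∞ →
      ρ (s ×ˢ t) = μ s * ν t) : μ.prod ν = ρ := by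
  exact Measure.prod_eq_generateFrom (generateFrom_measurableSet_measure_lt_top μ)
    (generateFrom_measurableSet_measure_lt_top ν) (isPiSystem_measure_lt_top μ)
    (isPiSystem_measure_lt_top ν) (Measure.finiteSpanningSetsIn_measure_lt_top μ)
    (Measure.finiteSpanningSetsIn_measure_lt_top ν) fun s hs t ht => h s t hs.1 ht.1 hs.2 ht.2

theorem ENNReal.tsum_mul_tsum_eq_diag_add_offDiag (a b : ℕ → ℝ≥0∞) :
    (∑' j, a j) * ∑' k, b k =
      ∑' j, a j * b j + ∑' q : {q : ℕ × ℕ // q.1 ≠ q.2}, a q.1.1 * b q.1.2 := by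
  let e : ℕ ≃ {q : ℕ × ℕ // q.1 = q.2} :=
    ⟨fun j => ⟨(j, j), rfl⟩, fun q => q.1.1, fun _ => rfl, fun q => Subtype.ext (Prod.ext rfl q.2)⟩
  have h1 : (∑' j, a j) * ∑' k, b k = ∑' q : ℕ × ℕ, a q.1 * b q.2 := by
    rw [ENNReal.tsum_prod', ← ENNReal.tsum_mul_right]
    simp_rw [ENNReal.tsum_mul_left]
  rw [h1, ← ENNReal.summable.tsum_add_tsum_compl (s := {q : ℕ × ℕ | q.1 = q.2}) ENNReal.summable]
  exact congrArg₂ _ (e.tsum_eq fun q => a q.1.1 * b q.1.2).symm rfl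

/-! ### First and second moment measures of the Poisson process. -/

section Poisson

variable {Ω : Type*} [MeasurableSpace Ω] {μ : Measure Ω} {Λ : ℝ≥0} {x : ℕ → Ω → Plane}

theorem countingMeasure_apply (y : ℕ → Plane) {B : Set Plane} (hB : MeasurableSet B) :
    countingMeasure y B = ∑' j, B.indicator 1 (y j) := by
  simp [countingMeasure, Measure.sum_apply _ hB, Measure.dirac_apply' _ hB]

theorem measurable_countingMeasure (hx : ∀ j, Measurable (x j)) {B : Set Plane}
    (hB : MeasurableSet B) : Measurable fun ω => countingMeasure (fun j => x j ω) B := by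
  simp_rw [countingMeasure_apply _ hB]
  exact Measurable.tsum fun j => (measurable_one.indicator hB).comp (hx j)

theorem lintegral_indicator_one_comp {y : Ω → Plane} (hy : Measurable y) {B : Set Plane}
    (hB : MeasurableSet B) : ∫⁻ ω, B.indicator 1 (y ω) ∂μ = μ.map y B := by
  rw [← lintegral_indicator_one hB, lintegral_map (measurable_one.indicator hB) hy]

namespace IsPoissonProcess

theorem lintegral_comp_count (hx : IsPoissonProcess μ Λ x) {B : Set Plane} (hB : MeasurableSet B)
    (hB' : volume B ≠ ∞) {g : ℝ≥0∞ → ℝ≥0∞} (hg : Measurable g) :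
    ∫⁻ ω, g (countingMeasure (fun j => x j ω) B) ∂μ =
      ∫⁻ n, g n ∂(poissonMeasure (Λ * (volume B).toNNReal)) := by
  rw [← lintegral_map hg (measurable_countingMeasure hx.measurable hB), hx.law_count B hB hB',
    lintegral_map hg (measurable_of_countable _)]

theorem lintegral_count (hx : IsPoissonProcess μ Λ x) {B : Set Plane} (hB : MeasurableSet B)
    (hB' : volume B ≠ ∞) :
    ∫⁻ ω, countingMeasure (fun j => x j ω) B ∂μ = Λ * volume B := by
  rw [hx.lintegral_comp_count hB hB' (g := fun a => a) measurable_id]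
  simp [lintegral_natCast_poissonMeasure, ENNReal.coe_toNNReal hB']

theorem lintegral_count_mul_self (hx : IsPoissonProcess μ Λ x) {B : Set Plane}
    (hB : MeasurableSet B) (hB' : volume B ≠ ∞) :
    ∫⁻ ω, countingMeasure (fun j => x j ω) B * countingMeasure (fun j => x j ω) B ∂μ =
      (Λ * volume B) * (Λ * volume B) + Λ * volume B := by
  rw [hx.lintegral_comp_count hB hB' (g := fun a => a * a) (by fun_prop)]
  simp [lintegral_natCast_mul_self_poissonMeasure, ENNReal.coe_toNNReal hB']

theorem lintegral_count_mul_count_of_disjoint (hx : IsPoissonProcess μ Λ x) {A B : Set Plane}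
    (hA : MeasurableSet A) (hA' : volume A ≠ ∞) (hB : MeasurableSet B) (hB' : volume B ≠ ∞)
    (hAB : Disjoint A B) :
    ∫⁻ ω, countingMeasure (fun j => x j ω) A * countingMeasure (fun j => x j ω) B ∂μ =
      (Λ * volume A) * (Λ * volume B) := by
  have hi := hx.indep_count 2 ![A, B] (by simp [Fin.forall_fin_two, hA, hB])
    (by simp [Fin.forall_fin_two, hA', hB'])
    (by
      intro i j hij
      fin_cases i <;> fin_cases j <;> simp_all [disjoint_comm])
  have hi' := hi.indepFun (i := 0) (j := 1) (by decide)
  simp only [Matrix.cons_val_zero, Matrix.cons_val_one] at hi'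
  rw [← hx.lintegral_count hA hA', ← hx.lintegral_count hB hB']
  exact lintegral_mul_eq_lintegral_mul_lintegral_of_indepFun
    (measurable_countingMeasure hx.measurable hA) (measurable_countingMeasure hx.measurable hB) hi'

/-- Cut A and B into the disjoint pieces A ∩ B, A \ B, B \ A and expand. Products of counts of
different pieces factor; only the square of the count of A ∩ B adds a Poisson variance. -/
theorem lintegral_count_mul_count (hx : IsPoissonProcess μ Λ x) {A B : Set Plane}
    (hA : MeasurableSet A) (hA' : volume A ≠ ∞) (hB : MeasurableSet B) (hB' : volume B ≠ ∞) :
    ∫⁻ ω, countingMeasure (fun j => x j ω) A * countingMeasure (fun j => x j ω) B ∂μ =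
      (Λ * volume A) * (Λ * volume B) + Λ * volume (A ∩ B) := by
  have fin {s t : Set Plane} (hst : s ⊆ t) (ht : volume t ≠ ∞) : volume s ≠ ∞ :=
    ((measure_mono hst).trans_lt ht.lt_top).ne
  have hC := hA.inter hB
  have hC' := fin (Set.inter_subset_left (s := A) (t := B)) hA'
  have hD := hA.diff hB
  have hD' := fin (Set.sdiff_subset (s := A) (t := B)) hA'
  have hE := hB.diff hA
  have hE' := fin (Set.sdiff_subset (s := B) (t := A)) hB'
  have mC := measurable_countingMeasure hx.measurable hC
  have mD := measurable_countingMeasure hx.measurable hD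
  have mE := measurable_countingMeasure hx.measurable hE
  have sA (ν : Measure Plane) : ν A = ν (A ∩ B) + ν (A \ B) := (measure_inter_add_sdiff A hB).symm
  have sB (ν : Measure Plane) : ν B = ν (A ∩ B) + ν (B \ A) := by
    rw [Set.inter_comm]; exact (measure_inter_add_sdiff B hA).symm
  have expand (ν : Measure Plane) : ν A * ν B =
      ν (A ∩ B) * ν (A ∩ B) + ν (A ∩ B) * ν (B \ A) + ν (A \ B) * ν (A ∩ B) +
        ν (A \ B) * ν (B \ A) := by
    rw [sA ν, sB ν]; ring
  simp_rw [expand]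
  rw [lintegral_add_right _ (by exact mD.mul mE), lintegral_add_right _ (by exact mD.mul mC),
    lintegral_add_right _ (by exact mC.mul mE), hx.lintegral_count_mul_self hC hC',
    hx.lintegral_count_mul_count_of_disjoint hC hC' hE hE'
      (Set.disjoint_sdiff_right.mono_left Set.inter_subset_left),
    hx.lintegral_count_mul_count_of_disjoint hD hD' hC hC'
      (Set.disjoint_sdiff_left.mono_right Set.inter_subset_right),
    hx.lintegral_count_mul_count_of_disjoint hD hD' hE hE'
      (Set.disjoint_sdiff_left.mono_right Set.sdiff_subset), sA volume, sB volume]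
  ring

/-- The intensity measure of a Poisson process. -/
theorem sum_map_eq (hx : IsPoissonProcess μ Λ x) :
    Measure.sum (fun j => μ.map (x j)) = Λ • (volume : Measure Plane) := by
  refine Measure.ext_of_forall_measure_lt_top volume fun B hB hB' => ?_
  rw [Measure.sum_apply _ hB, Measure.smul_apply, ENNReal.smul_def, smul_eq_mul,
    ← hx.lintegral_count hB hB'.ne]
  simp_rw [countingMeasure_apply _ hB]
  rw [lintegral_tsum fun j =>
    (by exact ((measurable_one.indicator hB).comp (hx.measurable j)).aemeasurable)]
  simp_rw [lintegral_indicator_one_comp (hx.measurable _) hB]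

/-- The second factorial moment measure of a Poisson process. -/
theorem sum_map_pair_eq (hx : IsPoissonProcess μ Λ x) (hΛ : Λ ≠ 0) :
    Measure.sum (fun q : {q : ℕ × ℕ // q.1 ≠ q.2} => μ.map fun ω => (x q.1.1 ω, x q.1.2 ω)) =
      (Λ • (volume : Measure Plane)).prod (Λ • (volume : Measure Plane)) := by
  symm
  refine Measure.prod_eq_of_forall_measure_lt_top fun A B hA hB hA' hB' => ?_
  -- This is where Λ ≠ 0 enters: for Λ = 0 every set would have finite scaled measure.
  have fin {s : Set Plane} (hs : (Λ • (volume : Measure Plane)) s < ∞) : volume s ≠ ∞ := by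
    intro h
    rw [Measure.smul_apply, h, ENNReal.smul_def, smul_eq_mul,
      ENNReal.mul_top (ENNReal.coe_ne_zero.2 hΛ)] at hs
    exact hs.ne rfl
  have hmul := hx.lintegral_count_mul_count hA (fin hA') hB (fin hB')
  have meas {C : Set Plane} (hC : MeasurableSet C) (j : ℕ) :
      Measurable fun ω => C.indicator (1 : Plane → ℝ≥0∞) (x j ω) :=
    (measurable_one.indicator hC).comp (hx.measurable j)
  simp_rw [countingMeasure_apply _ hA, countingMeasure_apply _ hB,
    ENNReal.tsum_mul_tsum_eq_diag_add_offDiag] at hmul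
  have meas₂ (j k : ℕ) : Measurable fun ω =>
      A.indicator (1 : Plane → ℝ≥0∞) (x j ω) * B.indicator (1 : Plane → ℝ≥0∞) (x k ω) :=
    (meas hA j).mul (meas hB k)
  rw [lintegral_add_left (Measurable.tsum fun j => meas₂ j j),
    lintegral_tsum fun j => (meas₂ j j).aemeasurable,
    lintegral_tsum fun q => (meas₂ _ _).aemeasurable] at hmul
  have hdiag : ∑' j, ∫⁻ ω, A.indicator 1 (x j ω) * B.indicator 1 (x j ω) ∂μ =
      Λ * volume (A ∩ B) := by
    have h := congrArg (fun ν => ν (A ∩ B)) hx.sum_map_eq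
    simp only [Measure.sum_apply _ (hA.inter hB), Measure.smul_apply, ENNReal.smul_def,
      smul_eq_mul] at h
    rw [← h]
    refine tsum_congr fun j => ?_
    rw [← lintegral_indicator_one_comp (hx.measurable j) (hA.inter hB)]
    simp_rw [Set.inter_indicator_one, Pi.mul_apply]
  -- The diagonal term equals the Poisson excess in the mixed moment; cancelling it in `ℝ≥0∞`
  -- requires it to be finite.
  have hne : (Λ : ℝ≥0∞) * volume (A ∩ B) ≠ ∞ := ENNReal.mul_ne_top ENNReal.coe_ne_top
    ((measure_mono Set.inter_subset_left).trans_lt (fin hA').lt_top).ne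
  rw [hdiag, add_comm, ENNReal.add_left_inj hne] at hmul
  rw [Measure.sum_apply _ (hA.prod hB)]
  simp only [Measure.smul_apply, ENNReal.smul_def, smul_eq_mul]
  rw [← hmul]
  refine tsum_congr fun q => ?_
  rw [Measure.map_apply ((hx.measurable _).prodMk (hx.measurable _)) (hA.prod hB),
    ← lintegral_indicator_one (((hx.measurable _).prodMk (hx.measurable _)) (hA.prod hB))]
  refine lintegral_congr fun ω => ?_
  by_cases h1 : x q.1.1 ω ∈ A <;> by_cases h2 : x q.1.2 ω ∈ B <;> simp [h1, h2]

end IsPoissonProcess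
end Poisson

/-! ### Campbell formulas for trajectories and marked shot noise. -/

section Mobility

variable {Ω : Type*} [MeasurableSpace Ω] {μ : Measure Ω} {Λ : ℝ≥0}
  {K : Kernel Plane (ℝ≥0 → Plane)} {X : ℕ → Ω → ℝ≥0 → Plane}

namespace MovesBy

theorem measurable_start (hX : MovesBy μ K X) (j : ℕ) : Measurable fun ω => X j ω 0 :=
  (measurable_pi_apply 0).comp (hX.measurable j)

theorem map_eq (hX : MovesBy μ K X) (j : ℕ) :
    μ.map (X j) = (μ.map fun ω => X j ω 0).bind K := by
  ext B hB
  have h := hX.law_given_start Set.univ .univ {j} (fun _ => B) fun _ => hB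
  simp only [Set.mem_univ, Set.ofPred_true, Set.univ_inter, Finset.mem_singleton, forall_eq,
    Finset.prod_singleton, Measure.restrict_univ] at h
  rw [Measure.map_apply (hX.measurable j) hB, Measure.bind_apply hB K.aemeasurable,
    lintegral_map (K.measurable_coe hB) (hX.measurable_start j)]
  exact h

/-- Campbell's formula for the trajectories of the interferers. -/
theorem tsum_lintegral (hX : MovesBy μ K X) (hP : IsPoissonProcess μ Λ fun j ω => X j ω 0)
    {f : (ℝ≥0 → Plane) → ℝ≥0∞} (hf : Measurable f) :
    ∑' j, ∫⁻ ω, f (X j ω) ∂μ = Λ * ∫⁻ w, f w ∂((volume : Measure Plane).bind K) := by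
  have hKf : Measurable fun x => ∫⁻ w, f w ∂(K x) := hf.lintegral_kernel
  have h (j : ℕ) : ∫⁻ ω, f (X j ω) ∂μ =
      ∫⁻ x, ∫⁻ w, f w ∂(K x) ∂(μ.map fun ω => X j ω 0) := by
    rw [← lintegral_map hf (hX.measurable j), hX.map_eq j,
      Measure.lintegral_bind K.aemeasurable hf.aemeasurable]
  simp_rw [h]
  rw [← lintegral_sum_measure, hP.sum_map_eq,
    Measure.lintegral_bind K.aemeasurable hf.aemeasurable, lintegral_smul_measure]
  rfl

variable [IsProbabilityMeasure μ] [IsMarkovKernel K]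

/-- Both sides are finite measures, so product sets suffice; there the identity is `law_given_start`
for the two indices, without conditioning on the start. -/
theorem map_pair_eq (hX : MovesBy μ K X) {j k : ℕ} (hjk : j ≠ k) :
    μ.map (fun ω => (X j ω, X k ω)) = (μ.map fun ω => (X j ω 0, X k ω 0)).bind (K ∥ₖ K) := by
  have hm := (hX.measurable j).prodMk (hX.measurable k)
  have hm₀ := (hX.measurable_start j).prodMk (hX.measurable_start k)
  have := Measure.isProbabilityMeasure_map (μ := μ) hm.aemeasurable
  have := Measure.isProbabilityMeasure_map (μ := μ) hm₀.aemeasurable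
  refine Measure.ext_prod fun {B C} hB hC => ?_
  have h := hX.law_given_start Set.univ .univ {j, k} (fun i => if i = j then B else C)
    fun i => by split_ifs <;> assumption
  simp only [Set.mem_univ, Set.ofPred_true, Set.univ_inter, Finset.mem_insert,
    Finset.mem_singleton, forall_eq_or_imp, forall_eq, if_true, hjk.symm, if_false,
    Finset.prod_pair hjk, Measure.restrict_univ] at h
  rw [Measure.map_apply hm (hB.prod hC), Measure.bind_apply (hB.prod hC) (Kernel.aemeasurable _),
    lintegral_map (Kernel.measurable_coe _ (hB.prod hC)) hm₀]
  simp_rw [Kernel.parallelComp_apply_prod]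
  exact h

theorem lintegral_mul_eq_of_ne (hX : MovesBy μ K X) {j k : ℕ} (hjk : j ≠ k)
    {f g : (ℝ≥0 → Plane) → ℝ≥0∞} (hf : Measurable f) (hg : Measurable g) :
    ∫⁻ ω, f (X j ω) * g (X k ω) ∂μ =
      ∫⁻ z, (∫⁻ w, f w ∂(K z.1)) * ∫⁻ w, g w ∂(K z.2) ∂(μ.map fun ω => (X j ω 0, X k ω 0)) := by
  have hfg : Measurable fun z : (ℝ≥0 → Plane) × (ℝ≥0 → Plane) => f z.1 * g z.2 := by fun_prop
  rw [← lintegral_map (f := fun z : (ℝ≥0 → Plane) × (ℝ≥0 → Plane) => f z.1 * g z.2) hfg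
    ((hX.measurable j).prodMk (hX.measurable k)), hX.map_pair_eq hjk,
    Measure.lintegral_bind (Kernel.aemeasurable _) hfg.aemeasurable]
  refine lintegral_congr fun z => ?_
  rw [Kernel.parallelComp_apply, lintegral_prod_mul hf.aemeasurable hg.aemeasurable]

/-- The second-order Campbell formula for the trajectories of the interferers. -/
theorem tsum_lintegral_pair (hX : MovesBy μ K X) (hP : IsPoissonProcess μ Λ fun j ω => X j ω 0)
    (hΛ : Λ ≠ 0) {f g : (ℝ≥0 → Plane) → ℝ≥0∞} (hf : Measurable f) (hg : Measurable g) :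
    ∑' q : {q : ℕ × ℕ // q.1 ≠ q.2}, ∫⁻ ω, f (X q.1.1 ω) * g (X q.1.2 ω) ∂μ =
      (Λ * ∫⁻ w, f w ∂((volume : Measure Plane).bind K)) *
        (Λ * ∫⁻ w, g w ∂((volume : Measure Plane).bind K)) := by
  have hKf : Measurable fun x => ∫⁻ w, f w ∂(K x) := hf.lintegral_kernel
  have hKg : Measurable fun x => ∫⁻ w, g w ∂(K x) := hg.lintegral_kernel
  simp_rw [fun q : {q : ℕ × ℕ // q.1 ≠ q.2} => hX.lintegral_mul_eq_of_ne q.2 hf hg]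
  rw [← lintegral_sum_measure, hP.sum_map_pair_eq hΛ,
    lintegral_prod_mul hKf.aemeasurable hKg.aemeasurable,
    Measure.lintegral_bind K.aemeasurable hf.aemeasurable,
    Measure.lintegral_bind K.aemeasurable hg.aemeasurable,
    lintegral_smul_measure, lintegral_smul_measure]
  rfl

end MovesBy

variable {E : Type*} [MeasurableSpace E] {F : ℕ → Ω → E}

/-- The mean of a shot noise with independent marks. -/
theorem lintegral_tsum_mark (hX : MovesBy μ K X) (hP : IsPoissonProcess μ Λ fun j ω => X j ω 0)
    (hF : ∀ j, Measurable (F j)) (hFX : IndepFun (fun ω j => F j ω) (fun ω j => X j ω) μ)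
    {f : (ℝ≥0 → Plane) → ℝ≥0∞} (hf : Measurable f) {U : E → ℝ≥0∞} (hU : Measurable U)
    {a : ℝ≥0∞} (ha : ∀ j, ∫⁻ ω, U (F j ω) ∂μ = a) :
    ∫⁻ ω, ∑' j, f (X j ω) * U (F j ω) ∂μ =
      Λ * (∫⁻ w, f w ∂((volume : Measure Plane).bind K)) * a := by
  have mX := hX.measurable
  rw [lintegral_tsum fun j => by fun_prop, ← hX.tsum_lintegral hP hf, ← ENNReal.tsum_mul_right]
  refine tsum_congr fun j => ?_
  rw [← ha j]
  exact lintegral_mul_eq_lintegral_mul_lintegral_of_indepFun (by fun_prop) (by fun_prop)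
    (hFX.symm.comp (φ := fun w : ℕ → ℝ≥0 → Plane => f (w j))
      (ψ := fun v : ℕ → E => U (v j)) (by fun_prop) (by fun_prop))

variable [IsProbabilityMeasure μ] [IsMarkovKernel K]

/-- The mixed second moment of two shot noises with independent marks. -/
theorem lintegral_tsum_mark_mul_tsum_mark (hX : MovesBy μ K X)
    (hP : IsPoissonProcess μ Λ fun j ω => X j ω 0) (hΛ : Λ ≠ 0)
    (hF : ∀ j, Measurable (F j)) (hFi : iIndepFun F μ)
    (hFX : IndepFun (fun ω j => F j ω) (fun ω j => X j ω) μ)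
    {f g : (ℝ≥0 → Plane) → ℝ≥0∞} (hf : Measurable f) (hg : Measurable g)
    {U V : E → ℝ≥0∞} (hU : Measurable U) (hV : Measurable V)
    {a b c : ℝ≥0∞} (ha : ∀ j, ∫⁻ ω, U (F j ω) ∂μ = a) (hb : ∀ j, ∫⁻ ω, V (F j ω) ∂μ = b)
    (hc : ∀ j, ∫⁻ ω, U (F j ω) * V (F j ω) ∂μ = c) :
    ∫⁻ ω, (∑' j, f (X j ω) * U (F j ω)) * ∑' k, g (X k ω) * V (F k ω) ∂μ =
      (Λ * (∫⁻ w, f w ∂((volume : Measure Plane).bind K)) * a) *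
        (Λ * (∫⁻ w, g w ∂((volume : Measure Plane).bind K)) * b) +
      Λ * (∫⁻ w, f w * g w ∂((volume : Measure Plane).bind K)) * c := by
  have mX := hX.measurable
  -- Independence of marks and motion splits every term into a motion factor and a mark factor; the
  -- latter is `c` on the diagonal and `a * b` off it.
  have key (j k : ℕ) : ∫⁻ ω, (f (X j ω) * U (F j ω)) * (g (X k ω) * V (F k ω)) ∂μ =
      (∫⁻ ω, f (X j ω) * g (X k ω) ∂μ) * ∫⁻ ω, U (F j ω) * V (F k ω) ∂μ := by
    simp_rw [mul_mul_mul_comm]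
    exact lintegral_mul_eq_lintegral_mul_lintegral_of_indepFun (by fun_prop) (by fun_prop)
      (hFX.symm.comp (φ := fun w : ℕ → ℝ≥0 → Plane => f (w j) * g (w k))
        (ψ := fun v : ℕ → E => U (v j) * V (v k)) (by fun_prop) (by fun_prop))
  have off {j k : ℕ} (hjk : j ≠ k) : ∫⁻ ω, U (F j ω) * V (F k ω) ∂μ = a * b := by
    rw [← ha j, ← hb k]
    exact lintegral_mul_eq_lintegral_mul_lintegral_of_indepFun (by fun_prop) (by fun_prop)
      ((hFi.indepFun hjk).comp hU hV)
  simp_rw [ENNReal.tsum_mul_tsum_eq_diag_add_offDiag]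
  rw [lintegral_add_left (Measurable.tsum fun j => by fun_prop),
    lintegral_tsum fun j => by fun_prop, lintegral_tsum fun q => by fun_prop, add_comm]
  simp_rw [key, hc, fun q : {q : ℕ × ℕ // q.1 ≠ q.2} => off q.2]
  rw [ENNReal.tsum_mul_right, ENNReal.tsum_mul_right, hX.tsum_lintegral_pair hP hΛ hf hg,
    hX.tsum_lintegral hP (f := fun w => f w * g w) (by fun_prop)]
  ring

end Mobility

/-! ### Trajectory intensity at one and at two times. -/

theorem PreservesHomogeneity.lintegral_eval {K : Kernel Plane (ℝ≥0 → Plane)}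
    (hK : PreservesHomogeneity K) (s : ℝ≥0) {f : Plane → ℝ≥0∞} (hf : Measurable f) :
    ∫⁻ w, f (w s) ∂((volume : Measure Plane).bind K) = ∫⁻ x, f x := by
  rw [← lintegral_map hf (measurable_pi_apply s), hK s]

/-- Agreement on rectangles extends to all measurable sets because the strips `spanningSets volume n
×ˢ univ` exhaust the space and have finite mass, `p` being Markov. -/
theorem IsTransition.map_eq_compProd {K : Kernel Plane (ℝ≥0 → Plane)} {s t : ℝ≥0}
    {p : Kernel Plane Plane} [IsMarkovKernel p] (hp : IsTransition K s t p) :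
    ((volume : Measure Plane).bind K).map (fun w => (w s, w t)) = volume ⊗ₘ p := by
  have hm : Measurable fun w : ℝ≥0 → Plane => (w s, w t) := by fun_prop
  have hrect {A B : Set Plane} (hA : MeasurableSet A) (hB : MeasurableSet B) :
      ((volume : Measure Plane).bind K).map (fun w => (w s, w t)) (A ×ˢ B) =
        (volume ⊗ₘ p) (A ×ˢ B) := by
    rw [Measure.map_apply hm (hA.prod hB), Measure.compProd_apply_prod hA hB]
    exact hp A B hA hB
  refine Measure.ext_of_generateFrom_of_iUnion _
    (fun n => spanningSets (volume : Measure Plane) n ×ˢ Set.univ) generateFrom_prod.symm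
    isPiSystem_prod ?_ (fun n => Set.mem_image2_of_mem
      (Set.mem_ofPred_eq.mpr (measurableSet_spanningSets (volume : Measure Plane) n))
      (Set.mem_ofPred_eq.mpr MeasurableSet.univ)) ?_ ?_
  · rw [← Set.iUnion_prod_const, iUnion_spanningSets, Set.univ_prod_univ]
  · intro n
    rw [hrect (measurableSet_spanningSets _ n) .univ,
      Measure.compProd_apply_prod (measurableSet_spanningSets _ n) .univ]
    simpa using (measure_spanningSets_lt_top (volume : Measure Plane) n).ne
  · rintro _ ⟨A, hA, B, hB, rfl⟩
    exact hrect hA hB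

theorem IsTransition.lintegral_mul {K : Kernel Plane (ℝ≥0 → Plane)} {s t : ℝ≥0}
    {p : Kernel Plane Plane} [IsMarkovKernel p] (hp : IsTransition K s t p)
    {f g : Plane → ℝ≥0∞} (hf : Measurable f) (hg : Measurable g) :
    ∫⁻ w, f (w s) * g (w t) ∂((volume : Measure Plane).bind K) =
      ∫⁻ x, f x * ∫⁻ y, g y ∂(p x) := by
  have hfg : Measurable fun z : Plane × Plane => f z.1 * g z.2 := by fun_prop
  rw [← lintegral_map (f := fun z : Plane × Plane => f z.1 * g z.2)
      (g := fun w : ℝ≥0 → Plane => (w s, w t)) hfg (by fun_prop),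
    hp.map_eq_compProd, Measure.lintegral_compProd hfg]
  simp_rw [lintegral_const_mul _ hg]

/-! ### Path loss in polar coordinates. -/

section PathLoss

theorem integrable_comp_norm_plane_iff {f : ℝ → ℝ} :
    Integrable (fun x : Plane => f ‖x‖) ↔ IntegrableOn (fun r => r * f r) (Set.Ioi 0) := by
  simpa using integrable_fun_norm_addHaar (volume : Measure Plane) (f := f)

theorem integral_comp_norm_plane_pos {f : ℝ → ℝ} (hf : 0 < ∫ r in Set.Ioi (0 : ℝ), r * f r) :
    0 < ∫ x : Plane, f ‖x‖ := by
  rw [integral_fun_norm_addHaar (volume : Measure Plane) f]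
  have hb : 0 < (volume : Measure Plane).real (Metric.ball 0 1) :=
    ENNReal.toReal_pos (Metric.measure_ball_pos _ _ one_pos).ne' measure_ball_lt_top.ne
  simp only [finrank_euclideanSpace, Fintype.card_fin, Nat.add_one_sub_one, pow_one, smul_eq_mul,
    nsmul_eq_mul]
  positivity

/-- If the truncated square integrates to 0, then f ≤ 0 almost everywhere, against the positive
integral. -/
theorem lintegral_ofReal_mul_self_pos {α : Type*} [MeasurableSpace α] {ν : Measure α} {f : α → ℝ}
    (hf : Measurable f) (hpos : 0 < ∫ x, f x ∂ν) :
    ∫⁻ x, ENNReal.ofReal (f x) * ENNReal.ofReal (f x) ∂ν ≠ 0 := by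
  intro h
  rw [lintegral_eq_zero_iff (by fun_prop)] at h
  refine hpos.not_ge (integral_nonpos_of_ae ?_)
  filter_upwards [h] with x hx
  simpa using hx

end PathLoss

/-! ### From extended nonnegative to real interference. -/

section Interference

variable {Ω : Type*} [MeasurableSpace Ω] {μ : Measure Ω}

/-- The interference at the origin as an extended nonnegative random variable. -/
noncomputable def einterference (l : ℝ → ℝ) (X : ℕ → Ω → ℝ≥0 → Plane) (F : ℕ → Ω → ℝ≥0 → ℝ)
    (s : ℝ≥0) (ω : Ω) : ℝ≥0∞ :=
  ∑' j, ENNReal.ofReal (l ‖X j ω s‖) * ENNReal.ofReal (F j ω s)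

theorem IsFading.ae_nonneg {F : ℕ → Ω → ℝ≥0 → ℝ} {h : Ω → ℝ} (hF : IsFading μ F h) (s : ℝ≥0) :
    ∀ᵐ ω ∂μ, ∀ j, 0 ≤ F j ω s :=
  ae_all_iff.2 fun j => (hF.identDistrib j s).symm.ae_snd measurableSet_Ici hF.nonneg

theorem IsFading.lintegral_comp {F : ℕ → Ω → ℝ≥0 → ℝ} {h : Ω → ℝ} (hF : IsFading μ F h)
    (j : ℕ) (s : ℝ≥0) {g : ℝ → ℝ≥0∞} (hg : Measurable g) :
    ∫⁻ ω, g (F j ω s) ∂μ = ∫⁻ ω, g (h ω) ∂μ :=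
  ((hF.identDistrib j s).comp hg).lintegral_eq

theorem measurable_einterference {l : ℝ → ℝ} (hl : Measurable l) {X : ℕ → Ω → ℝ≥0 → Plane}
    (hX : ∀ j, Measurable (X j)) {F : ℕ → Ω → ℝ≥0 → ℝ} (hF : ∀ j, Measurable (F j)) (s : ℝ≥0) :
    Measurable (einterference l X F s) :=
  Measurable.tsum fun j => by fun_prop

theorem interference_ae_eq {l : ℝ → ℝ} (hl : ∀ r, 0 ≤ r → 0 ≤ l r) (X : ℕ → Ω → ℝ≥0 → Plane)
    {F : ℕ → Ω → ℝ≥0 → ℝ} {h : Ω → ℝ} (hF : IsFading μ F h) (s : ℝ≥0) :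
    interference l X F s =ᵐ[μ] fun ω => (einterference l X F s ω).toReal := by
  filter_upwards [hF.ae_nonneg s] with ω hω
  rw [interference, einterference,
    -- No summability is needed here: a divergent sum becomes 0 on both sides.
    ENNReal.tsum_toReal_eq fun j => ENNReal.mul_ne_top ENNReal.ofReal_ne_top ENNReal.ofReal_ne_top]
  refine tsum_congr fun j => ?_
  rw [ENNReal.toReal_mul, ENNReal.toReal_ofReal (hl _ (norm_nonneg _)),
    ENNReal.toReal_ofReal (hω j)]

theorem ae_summable_of_einterference {l : ℝ → ℝ} (hl : ∀ r, 0 ≤ r → 0 ≤ l r)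
    {X : ℕ → Ω → ℝ≥0 → Plane} {F : ℕ → Ω → ℝ≥0 → ℝ} {h : Ω → ℝ} (hF : IsFading μ F h) {s : ℝ≥0}
    (hfin : ∀ᵐ ω ∂μ, einterference l X F s ω < ∞) :
    ∀ᵐ ω ∂μ, Summable fun j => l ‖X j ω s‖ * F j ω s := by
  filter_upwards [hF.ae_nonneg s, hfin] with ω hω hfin
  refine (ENNReal.summable_toReal hfin.ne).congr fun j => ?_
  rw [ENNReal.toReal_mul, ENNReal.toReal_ofReal (hl _ (norm_nonneg _)),
    ENNReal.toReal_ofReal (hω j)]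

theorem memLp_two_toReal {f : Ω → ℝ≥0∞} (hf : Measurable f) (hfin : ∫⁻ ω, f ω * f ω ∂μ ≠ ∞) :
    MemLp (fun ω => (f ω).toReal) 2 μ := by
  rw [memLp_two_iff_integrable_sq hf.ennreal_toReal.aestronglyMeasurable]
  have := integrable_toReal_of_lintegral_ne_top (hf.mul hf).aemeasurable hfin
  simpa [pow_two] using this

end Interference

theorem integral_toReal_mul_toReal {Ω : Type*} [MeasurableSpace Ω] {μ : Measure Ω}
    {f g : Ω → ℝ≥0∞} (hf : Measurable f) (hg : Measurable g) (hfin : ∫⁻ ω, f ω * g ω ∂μ ≠ ∞) :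
    ∫ ω, (f ω).toReal * (g ω).toReal ∂μ = (∫⁻ ω, f ω * g ω ∂μ).toReal := by
  simp_rw [← ENNReal.toReal_mul]
  exact integral_toReal (by fun_prop) (ae_lt_top (by fun_prop) hfin)

theorem lintegral_mul_ne_top_of_sq {α : Type*} [MeasurableSpace α] {ν : Measure α}
    {f g : α → ℝ≥0∞} (hf : Measurable f) (hff : ∫⁻ x, f x * f x ∂ν ≠ ∞)
    (hgg : ∫⁻ x, g x * g x ∂ν ≠ ∞) : ∫⁻ x, f x * g x ∂ν ≠ ∞ := by
  refine ne_top_of_le_ne_top (ENNReal.add_ne_top.2 ⟨hff, hgg⟩) ?_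
  rw [← lintegral_add_left (by fun_prop)]
  refine lintegral_mono fun x => ?_
  -- The product is at most the square of the larger factor.
  rcases le_total (f x) (g x) with h | h
  · exact le_add_left (mul_le_mul_left h _)
  · exact le_add_right (mul_le_mul_right h _)

theorem lintegral_ofReal_mul_self {α : Type*} [MeasurableSpace α] {ν : Measure α} {f : α → ℝ}
    (hf : 0 ≤ᵐ[ν] f) : ∫⁻ x, ENNReal.ofReal (f x) * ENNReal.ofReal (f x) ∂ν =
      ∫⁻ x, ENNReal.ofReal (f x ^ 2) ∂ν := by
  refine lintegral_congr_ae ?_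
  filter_upwards [hf] with x hx
  rw [pow_two, ENNReal.ofReal_mul hx]

/-! ### The correlation coefficient. -/

theorem mainTheorem10 {Ω : Type*} [MeasurableSpace Ω] (μ : Measure Ω) [IsProbabilityMeasure μ]
    -- the path-loss function
    (l : ℝ → ℝ) (hl_meas : Measurable l) (hl_nonneg : ∀ r, 0 ≤ r → 0 ≤ l r)
    (hl_int : IntegrableOn (fun r => r * l r) (Set.Ioi 0))
    (hl_sq : IntegrableOn (fun r => r * l r ^ 2) (Set.Ioi 0))
    (hl_pos : 0 < ∫ r in Set.Ioi (0 : ℝ), r * l r)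
    -- the moving interferers
    (Λ : ℝ≥0) (hΛ : 0 < Λ) (X : ℕ → Ω → ℝ≥0 → Plane)
    (hX₀ : IsPoissonProcess μ Λ (fun j ω => X j ω 0))
    (K : Kernel Plane (ℝ≥0 → Plane)) [IsMarkovKernel K] (hXK : MovesBy μ K X)
    (hK : PreservesHomogeneity K)
    -- the fading, with unit mean and finite second moment, independent of the motion
    (F : ℕ → Ω → ℝ≥0 → ℝ) (h : Ω → ℝ) (hF : IsFading μ F h)
    (hh_mean : ∫ ω, h ω ∂μ = 1) (hh_sq : MemLp h 2 μ)
    (hFX : IndepFun (fun ω j => F j ω) (fun ω j => X j ω) μ)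
    -- the two times, between which the fading decorrelates and the motion is described by `p`
    (t : ℝ≥0) (hFt : ∀ j, IndepFun (fun ω => F j ω t) (fun ω => F j ω (t + 1)) μ)
    (p : Kernel Plane Plane) [IsMarkovKernel p] (hp : IsTransition K t (t + 1) p) :
    (∀ s ∈ ({t, t + 1} : Set ℝ≥0),
      (∀ᵐ ω ∂μ, Summable fun j => l ‖X j ω s‖ * F j ω s) ∧
      MemLp (interference l X F s) 2 μ) ∧
    0 < Var[interference l X F t; μ] ∧
    Integrable (fun x : Plane => l ‖x‖ ^ 2) ∧
    (∀ᵐ x : Plane, Integrable (fun y : Plane => l ‖y‖) (p x)) ∧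
    Integrable (fun x : Plane => l ‖x‖ * ∫ y, l ‖y‖ ∂(p x)) ∧
    corrCoeff μ (interference l X F) t (t + 1) =
      (∫ x : Plane, l ‖x‖ * ∫ y, l ‖y‖ ∂(p x)) /
        ((∫ ω, h ω ^ 2 ∂μ) * ∫ x : Plane, l ‖x‖ ^ 2) := by
  have hL : Measurable fun x : Plane => ENNReal.ofReal (l ‖x‖) := by fun_prop
  have hl0 (x : Plane) : 0 ≤ l ‖x‖ := hl_nonneg _ (norm_nonneg x)
  have hl_int' : Integrable fun x : Plane => l ‖x‖ := integrable_comp_norm_plane_iff.2 hl_int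
  have hl_sq' : Integrable fun x : Plane => l ‖x‖ ^ 2 :=
    integrable_comp_norm_plane_iff (f := fun r => l r ^ 2).2 hl_sq
  obtain ⟨m, hm⟩ : ∃ m, m = ∫⁻ x : Plane, ENNReal.ofReal (l ‖x‖) := ⟨_, rfl⟩
  obtain ⟨m₂, hm₂⟩ : ∃ m₂, m₂ = ∫⁻ x : Plane, ENNReal.ofReal (l ‖x‖) * ENNReal.ofReal (l ‖x‖) :=
    ⟨_, rfl⟩
  obtain ⟨D, hD⟩ : ∃ D, D = ∫⁻ x : Plane, ENNReal.ofReal (l ‖x‖) *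
      ∫⁻ y : Plane, ENNReal.ofReal (l ‖y‖) ∂(p x) := ⟨_, rfl⟩
  obtain ⟨c, hc⟩ : ∃ c, c = ∫⁻ ω, ENNReal.ofReal (h ω) * ENNReal.ofReal (h ω) ∂μ := ⟨_, rfl⟩
  have hm_top : m ≠ ∞ := by
    rw [hm, ← ofReal_integral_eq_lintegral_ofReal hl_int' (.of_forall hl0)]
    exact ENNReal.ofReal_ne_top
  have hm₂_eq : m₂ = ENNReal.ofReal (∫ x : Plane, l ‖x‖ ^ 2) := by
    rw [hm₂, lintegral_ofReal_mul_self (.of_forall hl0),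
      ofReal_integral_eq_lintegral_ofReal hl_sq' (.of_forall fun x => sq_nonneg _)]
  have hm₂_top : m₂ ≠ ∞ := hm₂_eq ▸ ENNReal.ofReal_ne_top
  have hm₂_real : m₂.toReal = ∫ x : Plane, l ‖x‖ ^ 2 := by
    rw [hm₂_eq, ENNReal.toReal_ofReal (integral_nonneg fun x => sq_nonneg _)]
  have hm₂_pos : 0 < m₂.toReal := ENNReal.toReal_pos (hm₂ ▸ lintegral_ofReal_mul_self_pos
    (by fun_prop) (integral_comp_norm_plane_pos hl_pos)) hm₂_top
  have hc_eq : c = ENNReal.ofReal (∫ ω, h ω ^ 2 ∂μ) := by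
    rw [hc, lintegral_ofReal_mul_self hF.nonneg,
      ofReal_integral_eq_lintegral_ofReal hh_sq.integrable_sq (.of_forall fun x => sq_nonneg _)]
  have hc_top : c ≠ ∞ := hc_eq ▸ ENNReal.ofReal_ne_top
  have hc_real : c.toReal = ∫ ω, h ω ^ 2 ∂μ := by
    rw [hc_eq, ENNReal.toReal_ofReal (integral_nonneg fun x => sq_nonneg _)]
  have hc_pos : 0 < c.toReal := by
    -- E[h²] ≥ E[h]² = 1.
    have hv := variance_nonneg h μ
    rw [variance_eq_sub hh_sq, hh_mean] at hv
    simp only [Pi.pow_apply] at hv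
    linarith
  have hmean (s : ℝ≥0) (j : ℕ) : ∫⁻ ω, ENNReal.ofReal (F j ω s) ∂μ = 1 := by
    rw [hF.lintegral_comp j s ENNReal.measurable_ofReal, ← ofReal_integral_eq_lintegral_ofReal
      (hh_sq.integrable one_le_two) hF.nonneg, hh_mean, ENNReal.ofReal_one]
  have hLm (s : ℝ≥0) :
      ∫⁻ w, ENNReal.ofReal (l ‖w s‖) ∂((volume : Measure Plane).bind K) = m := by
    rw [hm, ← hK.lintegral_eval s hL]
  have hLm₂ (s : ℝ≥0) : ∫⁻ w, ENNReal.ofReal (l ‖w s‖) * ENNReal.ofReal (l ‖w s‖)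
      ∂((volume : Measure Plane).bind K) = m₂ := by
    rw [hm₂]
    exact hK.lintegral_eval s (hL.mul hL)
  have hLD : ∫⁻ w, ENNReal.ofReal (l ‖w t‖) * ENNReal.ofReal (l ‖w (t + 1)‖)
      ∂((volume : Measure Plane).bind K) = D := by
    rw [hD, ← hp.lintegral_mul hL hL]
  -- On trajectories, the product of the losses at the two times is bounded by the sum of their
  -- squares, and by homogeneity each square integrates to `m₂`.
  have hD_top : D ≠ ∞ := by
    rw [← hLD]
    exact lintegral_mul_ne_top_of_sq (by fun_prop) (by rwa [hLm₂]) (by rwa [hLm₂])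
  have mJ := measurable_einterference hl_meas hXK.measurable hF.measurable
  have hJ (s : ℝ≥0) : ∫⁻ ω, einterference l X F s ω ∂μ = Λ * m := by
    have := lintegral_tsum_mark hXK hX₀ hF.measurable hFX
      (f := fun w => ENNReal.ofReal (l ‖w s‖)) (by fun_prop)
      (U := fun v : ℝ≥0 → ℝ => ENNReal.ofReal (v s)) (by fun_prop) (hmean s)
    rwa [hLm, mul_one] at this
  have hJJ (s u : ℝ≥0) {e : ℝ≥0∞}
      (he : ∀ j, ∫⁻ ω, ENNReal.ofReal (F j ω s) * ENNReal.ofReal (F j ω u) ∂μ = e) :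
      ∫⁻ ω, einterference l X F s ω * einterference l X F u ω ∂μ = (Λ * m) * (Λ * m) +
        Λ * (∫⁻ w, ENNReal.ofReal (l ‖w s‖) * ENNReal.ofReal (l ‖w u‖)
          ∂((volume : Measure Plane).bind K)) * e := by
    have := lintegral_tsum_mark_mul_tsum_mark hXK hX₀ hΛ.ne' hF.measurable hF.indep hFX
      (f := fun w => ENNReal.ofReal (l ‖w s‖)) (g := fun w => ENNReal.ofReal (l ‖w u‖))
      (by fun_prop) (by fun_prop)
      (U := fun v : ℝ≥0 → ℝ => ENNReal.ofReal (v s)) (V := fun v : ℝ≥0 → ℝ => ENNReal.ofReal (v u))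
      (by fun_prop) (by fun_prop) (hmean s) (hmean u) he
    rwa [hLm, hLm, mul_one] at this
  have hJ_sq (s : ℝ≥0) : ∫⁻ ω, einterference l X F s ω * einterference l X F s ω ∂μ =
      (Λ * m) * (Λ * m) + Λ * m₂ * c := by
    rw [hJJ s s (e := c) fun j => ?_, hLm₂]
    rw [hc]
    exact hF.lintegral_comp j s (g := fun a => ENNReal.ofReal a * ENNReal.ofReal a) (by fun_prop)
  have hJ_mixed : ∫⁻ ω, einterference l X F t ω * einterference l X F (t + 1) ω ∂μ =
      (Λ * m) * (Λ * m) + Λ * D := by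
    have mF := hF.measurable
    rw [hJJ t (t + 1) (e := 1) fun j => ?_, hLD, mul_one]
    have hmul := lintegral_mul_eq_lintegral_mul_lintegral_of_indepFun
      (f := fun ω => ENNReal.ofReal (F j ω t)) (g := fun ω => ENNReal.ofReal (F j ω (t + 1)))
      (by fun_prop) (by fun_prop)
      ((hFt j).comp ENNReal.measurable_ofReal ENNReal.measurable_ofReal)
    rwa [hmean, hmean, one_mul] at hmul
  have hΛm : (Λ : ℝ≥0∞) * m ≠ ∞ := ENNReal.mul_ne_top ENNReal.coe_ne_top hm_top
  have hΛm₂ : (Λ : ℝ≥0∞) * m₂ * c ≠ ∞ :=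
    ENNReal.mul_ne_top (ENNReal.mul_ne_top ENNReal.coe_ne_top hm₂_top) hc_top
  have hΛD : (Λ : ℝ≥0∞) * D ≠ ∞ := ENNReal.mul_ne_top ENNReal.coe_ne_top hD_top
  have hJ_fin (s : ℝ≥0) : ∀ᵐ ω ∂μ, einterference l X F s ω < ∞ :=
    ae_lt_top (mJ s) (by rw [hJ]; exact hΛm)
  have hJ_sq_top (s : ℝ≥0) :
      ∫⁻ ω, einterference l X F s ω * einterference l X F s ω ∂μ ≠ ∞ := by
    rw [hJ_sq]
    exact ENNReal.add_ne_top.2 ⟨ENNReal.mul_ne_top hΛm hΛm, hΛm₂⟩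
  have hI (s : ℝ≥0) := interference_ae_eq hl_nonneg X hF s
  have hI_memLp (s : ℝ≥0) : MemLp (interference l X F s) 2 μ :=
    (memLp_congr_ae (hI s)).2 (memLp_two_toReal (mJ s) (hJ_sq_top s))
  have hI_mean (s : ℝ≥0) : ∫ ω, interference l X F s ω ∂μ = Λ * m.toReal := by
    rw [integral_congr_ae (hI s), integral_toReal (mJ s).aemeasurable (hJ_fin s), hJ,
      ENNReal.toReal_mul, ENNReal.coe_toReal]
  have hI_sq (s : ℝ≥0) : ∫ ω, interference l X F s ω ^ 2 ∂μ =
      (Λ * m.toReal) ^ 2 + Λ * m₂.toReal * c.toReal := by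
    have : (fun ω => interference l X F s ω ^ 2) =ᵐ[μ] fun ω =>
        (einterference l X F s ω).toReal * (einterference l X F s ω).toReal := by
      filter_upwards [hI s] with ω hω
      rw [hω, pow_two]
    rw [integral_congr_ae this, integral_toReal_mul_toReal (mJ s) (mJ s) (hJ_sq_top s), hJ_sq,
      ENNReal.toReal_add (ENNReal.mul_ne_top hΛm hΛm) hΛm₂]
    simp only [ENNReal.toReal_mul, ENNReal.coe_toReal]
    ring
  have hI_mixed : ∫ ω, interference l X F t ω * interference l X F (t + 1) ω ∂μ =
      (Λ * m.toReal) ^ 2 + Λ * D.toReal := by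
    have : (fun ω => interference l X F t ω * interference l X F (t + 1) ω) =ᵐ[μ] fun ω =>
        (einterference l X F t ω).toReal * (einterference l X F (t + 1) ω).toReal := by
      filter_upwards [hI t, hI (t + 1)] with ω hω hω'
      rw [hω, hω']
    rw [integral_congr_ae this, integral_toReal_mul_toReal (mJ _) (mJ _), hJ_mixed,
      ENNReal.toReal_add (ENNReal.mul_ne_top hΛm hΛm) hΛD]
    · simp only [ENNReal.toReal_mul, ENNReal.coe_toReal]
      ring
    · rw [hJ_mixed]
      exact ENNReal.add_ne_top.2 ⟨ENNReal.mul_ne_top hΛm hΛm, hΛD⟩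
  have hΛ' : (0 : ℝ) < Λ := hΛ
  have hp_fin : ∀ᵐ x : Plane, ∫⁻ y : Plane, ENNReal.ofReal (l ‖y‖) ∂(p x) < ∞ := by
    refine ae_lt_top hL.lintegral_kernel ?_
    -- With first factor 1, the double integral against `p` is the mean path loss at time `t + 1`,
    -- which homogeneity makes equal to `m`.
    have := hp.lintegral_mul (f := fun _ => 1) measurable_const hL
    simp only [one_mul] at this
    rw [← this, hLm]
    exact hm_top
  have hG : Measurable fun x : Plane => ENNReal.ofReal (l ‖x‖) *
      ∫⁻ y : Plane, ENNReal.ofReal (l ‖y‖) ∂(p x) := hL.mul hL.lintegral_kernel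
  -- Valid for every x: where the inner integral diverges, both conventions give 0.
  have hG_real (x : Plane) : l ‖x‖ * ∫ y, l ‖y‖ ∂(p x) = (ENNReal.ofReal (l ‖x‖) *
      ∫⁻ y : Plane, ENNReal.ofReal (l ‖y‖) ∂(p x)).toReal := by
    rw [ENNReal.toReal_mul, ENNReal.toReal_ofReal (hl0 x),
      integral_eq_lintegral_of_nonneg_ae (.of_forall hl0)
        (by fun_prop : Measurable fun y : Plane => l ‖y‖).aestronglyMeasurable]
  refine ⟨fun s _ => ⟨ae_summable_of_einterference hl_nonneg hF (hJ_fin s), hI_memLp s⟩, ?_,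
    hl_sq', ?_, ?_, ?_⟩
  · rw [variance_eq_sub (hI_memLp t)]
    simp only [Pi.pow_apply]
    rw [hI_sq, hI_mean, add_sub_cancel_left]
    positivity
  · filter_upwards [hp_fin] with x hx
    refine ⟨(by fun_prop : Measurable fun y : Plane => l ‖y‖).aestronglyMeasurable, ?_⟩
    rwa [hasFiniteIntegral_iff_ofReal (.of_forall hl0)]
  · simp_rw [hG_real]
    exact integrable_toReal_of_lintegral_ne_top hG.aemeasurable (hD ▸ hD_top)
  · simp_rw [hG_real]
    rw [integral_toReal hG.aemeasurable (ae_lt_top hG (hD ▸ hD_top)), ← hD, ← hc_real, ← hm₂_real,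
      corrCoeff, hI_mixed, hI_sq, hI_mean, add_sub_cancel_left, add_sub_cancel_left]
    -- What remains is Λ D / (Λ m₂ c), with Λ, m₂ and c positive.
    field_simp
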